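/- Let $p,m\in\mathbb{N}$ and let $\alpha=(\alpha_1,\dots,\alpha_p)$ with $\alpha_i\in(0,\infty)\setminus\mathbb{N}$. Put $n_i=[\alpha_i]+1$ and $\mathbf{n}=(n_1,\dots,n_p)$, and say that $\mathbf{x}=(x_1,\dots,x_p)$ is of class $C^{\mathbf n}$ on $(0,\infty)$ if each $x_i$ is of class $C^{n_i}$ on $(0,\infty)$. For an order $\beta\in(0,\infty)\setminus\mathbb{N}$ and $n=[\beta]+1$, consider the three fractional derivatives at $t>0$ $$^{C}D^{\beta}g(t)=\frac{1}{\Gamma(n-\beta)}\int_0^t(t-s)^{n-\beta-1}g^{(n)}(s)\,ds,\qquad {}^{RL}D^{\beta}g(t)=\frac{1}{\Gamma(n-\beta)}\Big(\frac{d}{dt}\Big)^{n}\int_0^t(t-s)^{n-\beta-1}g(s)\,ds,$$ $$^{GL}D^{\beta}g(t)=\lim_{h\to0^+}h^{-\beta}\sum_{r=0}^{[t/h]}(-1)^r\binom{\beta}{r}g(t-rh)$$ (Caputo, Riemann–Liouville, Grünwald–Letnikov). Let $\mathbf f:[0,\infty)\times\mathbb{R}^{p(m+1)}\to\mathbb{R}^p$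 be any function that is $T$-periodic in its first argument, where $T>0$, i.e. $\mathbf f(t+T,v)=\mathbf f(t,v)$ for all $t\ge 0$ and all $v$. Consider the system $$D^{\alpha}\mathbf{x}(t)=\mathbf f\big(t,\mathbf x(t),\mathbf x'(t),\dots,\mathbf x^{(m)}(t)\big),\qquad t>0,$$ where $D^{\alpha}\mathbf x=(D^{\alpha_1}x_1,\dots,D^{\alpha_p}x_p)^{T}$ and each $D^{\alpha_i}$ is one of the three fractional derivatives above (the choice may depend on $i$). Then for every integer $k\ge1$ the system has no solution of class $C^{\mathbf n}$ that is $kT$-periodic (that is, $\mathbf x(t+kT)=\mathbf x(t)$ for all $t>0$) and non-constant on $(0,\infty)$. -/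

import Mathlib

open Filter Topology

/-- The three classical notions of fractional-order derivative. -/
inductive FracKind where
  | caputo
  | riemannLiouville
  | grunwaldLetnikov

/-- The integer `n = [α] + 1` attached to an order of differentiation `α > 0`. -/
noncomputable def fracOrder (α : ℝ) : ℕ := ⌊α⌋₊ + 1

/-- Caputo derivative of order `α` with lower terminal `0`:
`1 / Γ(n - α) * ∫₀ᵗ (t - s)^(n - α - 1) g⁽ⁿ⁾(s) ds`, where `n = [α] + 1`. -/
noncomputable def caputoDeriv (α : ℝ) (g : ℝ → ℝ) (t : ℝ) : ℝ :=
  1 / Real.Gamma ((fracOrder α : ℝ) - α) *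
    ∫ s in (0 : ℝ)..t, (t - s) ^ ((fracOrder α : ℝ) - α - 1) * iteratedDeriv (fracOrder α) g s

/-- Riemann-Liouville derivative of order `α` with lower terminal `0`:
`1 / Γ(n - α) * (d/dt)ⁿ ∫₀ᵗ (t - s)^(n - α - 1) g(s) ds`, where `n = [α] + 1`. -/
noncomputable def rlDeriv (α : ℝ) (g : ℝ → ℝ) (t : ℝ) : ℝ :=
  1 / Real.Gamma ((fracOrder α : ℝ) - α) *
    iteratedDeriv (fracOrder α)
      (fun u : ℝ => ∫ s in (0 : ℝ)..u, (u - s) ^ ((fracOrder α : ℝ) - α - 1) * g s) t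

/-- The Grunwald-Letnikov difference quotient of step `h > 0` with lower terminal `0`:
`h^(-α) * ∑_{r = 0}^{[t / h]} (-1)^r (α choose r) g(t - r h)`. -/
noncomputable def glQuotient (α : ℝ) (g : ℝ → ℝ) (t h : ℝ) : ℝ :=
  h ^ (-α) * ∑ r ∈ Finset.range (⌊t / h⌋₊ + 1),
    (-1 : ℝ) ^ r * Ring.choose α r * g (t - r * h)

/-- `HasFracDeriv K α g t y`: the fractional derivative of kind `K` and order `α` (with lower
terminal `0`) of `g` at the time `t` is `y`. -/
def HasFracDeriv : FracKind → ℝ → (ℝ → ℝ) → ℝ → ℝ → Prop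
  | .caputo, α, g, t, y => caputoDeriv α g t = y
  | .riemannLiouville, α, g, t, y => rlDeriv α g t = y
  | .grunwaldLetnikov, α, g, t, y => Tendsto (glQuotient α g t) (𝓝[>] 0) (𝓝 y)

/-- `x` is of class `C^𝐧` on the open half-line, `𝐧 = ([α₁] + 1, …, [α_p] + 1)`. -/
def IsClassCn {p : ℕ} (α : Fin p → ℝ) (x : ℝ → Fin p → ℝ) : Prop :=
  ∀ i, ContDiffOn ℝ (fracOrder (α i) : ℕ) (fun s => x s i) (Set.Ioi 0)

/-- `x` solves `D^α x(t) = f(t, x(t), x'(t), …, x⁽ᵐ⁾(t))` for `t > 0`, where the derivative in the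
`i`-th component is of kind `K i` and order `α i`. The derivatives of `x` up to the order `m`
are required to exist. The argument `v` of `f t v` stands for the array `v j i = x_i⁽ʲ⁾(t)`. -/
def IsFracSolution {p : ℕ} (K : Fin p → FracKind) (α : Fin p → ℝ) (m : ℕ)
    (f : ℝ → (Fin (m + 1) → Fin p → ℝ) → Fin p → ℝ) (x : ℝ → Fin p → ℝ) : Prop :=
  ∀ t : ℝ, 0 < t →
    (∀ i, ∀ j < m, DifferentiableAt ℝ (iteratedDeriv j (fun s => x s i)) t) ∧
    ∀ i, HasFracDeriv (K i) (α i) (fun s => x s i) t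
      (f t (fun j l => iteratedDeriv j (fun s => x s l) t) i)

/-! ### Generalised binomial coefficients -/

/-! Along a solution of period `P = k * T` the right-hand side is `P`-periodic too, so each
component and its fractional derivative share the period `P`. The claim thus reduces to scalar
functions (`exists_const_of_hasFracDeriv_periodic`). The obstruction is memory: the kernel starts at
`0`, so passing from `t` to `t + P` adds the contribution of one extra period, `∫₀ᴾ (t + P - s)^β
w(s) ds`, which must vanish along arbitrarily large times. Expanding the kernel in powers of `s /
t`, with no binomial coefficient zero because `β` is not a natural number, kills every moment of
`w`, and Weierstrass gives `w = 0` (`eq_zero_of_integral_rpow_sub_eq_zero`).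

For Caputo, `w` is the `n`-th derivative, so `g` is a bounded polynomial, hence constant. For
Riemann-Liouville, `w` is the periodic extension of `g`; the extra term has zero `n`-th derivative
and decays, so it vanishes. For Grünwald-Letnikov, steps `P / N` at times `j * P` turn the extra
terms into a Riemann sum with limiting exponent `β = -α - 1` (`tendsto_glQuotient_sub`). In the last
two cases `g = 0`. -/

lemma ring_choose_eq_prod_div (a : ℝ) (n : ℕ) :
    Ring.choose a n = (∏ j ∈ Finset.range n, (a - j)) / n.factorial := by
  have h := Ring.descPochhammer_eq_factorial_smul_choose a n
  rw [Polynomial.descPochhammer_smeval_eq_ascPochhammer] at h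
  rw [Polynomial.ascPochhammer_smeval_eq_eval] at h
  rw [← descPochhammer_eval_eq_ascPochhammer, descPochhammer_eval_eq_prod_range, nsmul_eq_mul] at h
  rw [h]
  field_simp

lemma ring_choose_ne_zero {a : ℝ} (ha : ∀ j : ℕ, a ≠ j) (n : ℕ) : Ring.choose a n ≠ 0 := by
  rw [ring_choose_eq_prod_div]
  refine div_ne_zero (Finset.prod_ne_zero_iff.2 fun j _ => sub_ne_zero.2 (ha j)) ?_
  exact_mod_cast n.factorial_ne_zero

lemma neg_one_pow_mul_ring_choose (a : ℝ) (n : ℕ) :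
    (-1 : ℝ) ^ n * Ring.choose a n = (∏ j ∈ Finset.range n, (-a + j)) / n.factorial := by
  rw [ring_choose_eq_prod_div, ← mul_div_assoc]
  congr 1
  have : ∀ j ∈ Finset.range n, (-a + j : ℝ) = (-1) * (a - j) := fun j _ => by ring
  rw [Finset.prod_congr rfl this, Finset.prod_mul_distrib]
  simp

/-- Asymptotics of the binomial coefficients: `(-1)ʳ (a choose r) ~ r ^ (-a - 1) / Γ(-a)`. -/
lemma tendsto_ring_choose_mul_rpow {a : ℝ} (ha : ∀ j : ℕ, a ≠ j) :
    Tendsto (fun r : ℕ => (-1 : ℝ) ^ r * Ring.choose a r * (r : ℝ) ^ (a + 1)) atTop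
      (𝓝 (Real.Gamma (-a))⁻¹) := by
  have hΓ : Real.Gamma (-a) ≠ 0 := Real.Gamma_ne_zero fun m h => ha m (by linarith)
  -- The product in `Real.GammaSeq (-a) r` has one factor, `-a + r`, more than the binomial
  -- coefficient; the quotient tending to `1` removes it.
  have h1 : Tendsto (fun r : ℕ => (Real.GammaSeq (-a) r)⁻¹ * ((r : ℝ) / ((-a) + r))) atTop
      (𝓝 ((Real.Gamma (-a))⁻¹ * 1)) := by
    refine ((Real.GammaSeq_tendsto_Gamma (-a)).inv₀ hΓ).mul ?_
    simpa [add_comm] using tendsto_natCast_div_add_atTop (-a)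
  rw [mul_one] at h1
  refine h1.congr' ?_
  filter_upwards [eventually_gt_atTop 0] with r hr
  have hr' : (0 : ℝ) < r := by exact_mod_cast hr
  have hne : ∀ j : ℕ, -a + (j : ℝ) ≠ 0 := fun j h => ha j (by linarith)
  have hprod : (∏ j ∈ Finset.range r, (-a + j : ℝ)) ≠ 0 :=
    Finset.prod_ne_zero_iff.2 fun j _ => hne j
  rw [neg_one_pow_mul_ring_choose, Real.GammaSeq, Finset.prod_range_succ, Real.rpow_neg hr'.le,
    Real.rpow_add_one hr'.ne']
  have := hne r
  have : (r.factorial : ℝ) ≠ 0 := by exact_mod_cast r.factorial_ne_zero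
  have : (r : ℝ) ^ a ≠ 0 := (Real.rpow_pos_of_pos hr' a).ne'
  field_simp

lemma tendsto_ring_choose_mul_rpow_self {a : ℝ} (ha : ∀ j : ℕ, a ≠ j) :
    Tendsto (fun r : ℕ => (-1 : ℝ) ^ r * Ring.choose a r * (r : ℝ) ^ a) atTop (𝓝 0) := by
  have h := (tendsto_ring_choose_mul_rpow ha).mul tendsto_inv_atTop_nhds_zero_nat
  rw [mul_zero] at h
  refine h.congr' ?_
  filter_upwards [eventually_gt_atTop 0] with r hr
  have hr' : (0 : ℝ) < r := by exact_mod_cast hr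
  rw [Real.rpow_add_one hr'.ne']
  field_simp

/-! ### Uniqueness for the truncated Riemann-Liouville kernel -/

lemma exists_rpow_one_add_sub_sum_le (β : ℝ) (m : ℕ) : ∃ C > 0, ∃ δ > 0, ∀ y : ℝ, |y| < δ →
    |(1 + y) ^ β - ∑ k ∈ Finset.range m, Ring.choose β k * y ^ k| ≤ C * |y| ^ m := by
  have h := (Real.one_add_rpow_hasFPowerSeriesAt_zero (a := β)).isBigO_sub_partialSum_pow m
  obtain ⟨C, hC, h⟩ := h.exists_pos
  rw [Asymptotics.IsBigOWith, Metric.eventually_nhds_iff] at h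
  obtain ⟨δ, hδ, h⟩ := h
  refine ⟨C, hC, δ, hδ, fun y hy => ?_⟩
  have := @h y (by simpa using hy)
  have e : ∀ k, binomialSeries ℝ β k (fun _ => y) = Ring.choose β k * y ^ k := fun k => by
    rw [binomialSeries_apply]; simp
  simpa only [FormalMultilinearSeries.partialSum, e, zero_add, Real.norm_eq_abs, abs_pow,
    abs_abs] using this

/-- After factoring out `τ ^ β`, expand `(1 - s / τ) ^ β` through order `m`. The lower moments
vanish by induction, so the `m`-th term, of size `τ ^ (-m)`, equals a remainder of size `τ ^ (-m -
1)`. Letting `τ → ∞` forces its coefficient to be zero. -/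
lemma moment_eq_zero_of_integral_rpow_sub_eq_zero {w : ℝ → ℝ} (hw : Continuous w) {β : ℝ}
    (hβ : ∀ j : ℕ, β ≠ j) {P : ℝ} (hP : 0 < P) {τ : ℕ → ℝ} (hτ : Tendsto τ atTop atTop)
    (h : ∀ᶠ j in atTop, ∫ s in (0 : ℝ)..P, (τ j - s) ^ β * w s = 0) (m : ℕ) :
    ∫ s in (0 : ℝ)..P, s ^ m * w s = 0 := by
  induction m using Nat.strong_induction_on with
  | _ m ih =>
  obtain ⟨C, hC, δ, hδ, hbin⟩ := exists_rpow_one_add_sub_sum_le β (m + 1)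
  obtain ⟨B, hB⟩ := isCompact_Icc.exists_bound_of_continuousOn (s := Set.Icc 0 P) hw.continuousOn
  set M := ∫ s in (0 : ℝ)..P, s ^ m * w s with hM
  have key : ∀ᶠ j in atTop, |Ring.choose β m * M| ≤ (C * P ^ (m + 1) * B * P) * (τ j)⁻¹ := by
    filter_upwards [h, hτ.eventually_gt_atTop P, hτ.eventually_gt_atTop (P / δ)] with j hj hjP hjδ
    set t := τ j
    have ht : 0 < t := hP.trans hjP
    have hcont : ContinuousOn (fun s => (1 + -s / t) ^ β * w s) (Set.uIcc 0 P) := by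
      rw [Set.uIcc_of_le hP.le]
      refine ContinuousOn.mul (ContinuousOn.rpow_const (by fun_prop) fun s hs => Or.inl ?_)
        hw.continuousOn
      have : s / t < 1 := (div_lt_one ht).2 (hs.2.trans_lt hjP)
      have : -s / t = -(s / t) := by ring
      linarith
    have h0 : ∫ s in (0 : ℝ)..P, (1 + -s / t) ^ β * w s = 0 := by
      have : ∀ s ∈ Set.uIcc 0 P, (t - s) ^ β * w s = t ^ β * ((1 + -s / t) ^ β * w s) := by
        intro s hs
        rw [Set.uIcc_of_le hP.le] at hs
        have hst : s / t ≤ 1 := ((div_lt_one ht).2 (hs.2.trans_lt hjP)).le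
        rw [← mul_assoc, ← Real.mul_rpow ht.le]
        · congr 2
          field_simp
          ring
        · have : -s / t = -(s / t) := by ring
          linarith
      rw [intervalIntegral.integral_congr this, intervalIntegral.integral_const_mul] at hj
      exact (mul_eq_zero.1 hj).resolve_left (Real.rpow_pos_of_pos ht β).ne'
    have hsum : ∫ s in (0 : ℝ)..P,
        (∑ k ∈ Finset.range (m + 1), Ring.choose β k * (-s / t) ^ k) * w s
          = Ring.choose β m * (-1 / t) ^ m * M := by
      have e : ∀ s : ℝ, (∑ k ∈ Finset.range (m + 1), Ring.choose β k * (-s / t) ^ k) * w s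
          = ∑ k ∈ Finset.range (m + 1), Ring.choose β k * (-1 / t) ^ k * (s ^ k * w s) := by
        intro s
        rw [Finset.sum_mul]
        refine Finset.sum_congr rfl fun k _ => ?_
        rw [show -s / t = -1 / t * s by ring, mul_pow]
        ring
      simp_rw [e]
      rw [intervalIntegral.integral_finsetSum
        fun k _ => (Continuous.intervalIntegrable (by fun_prop) _ _)]
      simp_rw [intervalIntegral.integral_const_mul]
      rw [Finset.sum_range_succ, Finset.sum_eq_zero, zero_add]
      intro k hk
      rw [ih k (Finset.mem_range.1 hk), mul_zero]
    have hdiff : ∫ s in (0 : ℝ)..P, ((1 + -s / t) ^ β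
        - ∑ k ∈ Finset.range (m + 1), Ring.choose β k * (-s / t) ^ k) * w s
          = - (Ring.choose β m * (-1 / t) ^ m * M) := by
      simp_rw [sub_mul]
      rw [intervalIntegral.integral_sub hcont.intervalIntegrable
        (Continuous.intervalIntegrable (by fun_prop) _ _), h0, hsum, zero_sub]
    have hle : ‖∫ s in (0 : ℝ)..P, ((1 + -s / t) ^ β
        - ∑ k ∈ Finset.range (m + 1), Ring.choose β k * (-s / t) ^ k) * w s‖
          ≤ (C * (P / t) ^ (m + 1) * B) * |P - 0| := by
      refine intervalIntegral.norm_integral_le_of_norm_le_const fun s hs => ?_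
      rw [Set.uIoc_of_le hP.le] at hs
      have habs : |-s / t| = s / t := by
        rw [abs_div, abs_neg, abs_of_pos hs.1, abs_of_pos ht]
      have hsP : s / t ≤ P / t := by gcongr; exact hs.2
      have hPδ : P / t < δ := by
        rw [div_lt_iff₀ hδ] at hjδ
        rw [div_lt_iff₀ ht]
        linarith
      rw [norm_mul]
      refine mul_le_mul ?_ (hB s ⟨hs.1.le, hs.2⟩) (norm_nonneg _) (by positivity)
      refine (hbin (-s / t) (by rw [habs]; linarith)).trans ?_
      rw [habs]
      have : 0 ≤ s / t := div_nonneg hs.1.le ht.le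
      gcongr
    rw [hdiff, norm_neg, Real.norm_eq_abs, sub_zero, abs_of_pos hP] at hle
    have e1 : |Ring.choose β m * (-1 / t) ^ m * M| = |Ring.choose β m * M| * (t⁻¹) ^ m := by
      rw [abs_mul, abs_mul, abs_mul, abs_pow, abs_div, abs_neg, abs_one, abs_of_pos ht, one_div]
      ring
    rw [e1] at hle
    have htm : 0 < (t⁻¹) ^ m := by positivity
    refine le_of_mul_le_mul_right (hle.trans_eq ?_) htm
    rw [div_pow, pow_succ t, inv_pow]
    field_simp
  have hlim : Tendsto (fun j => (C * P ^ (m + 1) * B * P) * (τ j)⁻¹) atTop (𝓝 0) := by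
    simpa using (tendsto_inv_atTop_zero.comp hτ).const_mul (C * P ^ (m + 1) * B * P)
  have h0 : |Ring.choose β m * M| ≤ 0 := ge_of_tendsto hlim key
  have := abs_eq_zero.1 (le_antisymm h0 (abs_nonneg _))
  exact (mul_eq_zero.1 this).resolve_left (ring_choose_ne_zero hβ m)

/-- Since `w` is orthogonal to every polynomial `p`, `∫ w² = ∫ (w - p) w`, which is arbitrarily
small by Weierstrass approximation. -/
lemma eq_zero_of_forall_moment_eq_zero {w : ℝ → ℝ} (hw : Continuous w) {P : ℝ} (hP : 0 < P)
    (h : ∀ m : ℕ, ∫ s in (0 : ℝ)..P, s ^ m * w s = 0) : ∀ s ∈ Set.Icc 0 P, w s = 0 := by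
  have hpoly : ∀ p : Polynomial ℝ, ∫ s in (0 : ℝ)..P, p.eval s * w s = 0 := by
    intro p
    simp_rw [Polynomial.eval_eq_sum_range, Finset.sum_mul, mul_assoc]
    rw [intervalIntegral.integral_finsetSum
        fun k _ => (Continuous.intervalIntegrable (by fun_prop) _ _)]
    simp [intervalIntegral.integral_const_mul, h]
  obtain ⟨B, hB⟩ := isCompact_Icc.exists_bound_of_continuousOn (s := Set.Icc 0 P) hw.continuousOn
  have hsq : ∫ s in (0 : ℝ)..P, w s ^ 2 ≤ 0 := by
    refine le_of_forall_pos_le_add fun ε hε => ?_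
    have hB0 : 0 ≤ B := (norm_nonneg _).trans (hB 0 ⟨le_rfl, hP.le⟩)
    obtain ⟨p, hp⟩ := exists_polynomial_near_of_continuousOn 0 P w hw.continuousOn
      (ε / ((B + 1) * P)) (by positivity)
    have e : ∫ s in (0 : ℝ)..P, w s ^ 2 = ∫ s in (0 : ℝ)..P, (w s - p.eval s) * w s := by
      simp_rw [sub_mul]
      rw [intervalIntegral.integral_sub (Continuous.intervalIntegrable (by fun_prop) _ _)
        (Continuous.intervalIntegrable (by fun_prop) _ _), hpoly, sub_zero]
      simp_rw [sq]
    rw [e]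
    have := intervalIntegral.norm_integral_le_of_norm_le_const (a := 0) (b := P)
      (f := fun s => (w s - p.eval s) * w s) (C := ε / ((B + 1) * P) * (B + 1)) fun s hs => by
        rw [Set.uIoc_of_le hP.le] at hs
        have hs' : s ∈ Set.Icc 0 P := ⟨hs.1.le, hs.2⟩
        rw [norm_mul]
        refine mul_le_mul ?_ ((hB s hs').trans (by linarith)) (norm_nonneg _) (by positivity)
        rw [Real.norm_eq_abs, abs_sub_comm]
        exact (hp s hs').le
    rw [sub_zero, abs_of_pos hP] at this
    refine (le_abs_self _).trans (this.trans_eq ?_)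
    field_simp
    ring
  intro s hs
  by_contra hne
  have : 0 < ∫ s in (0 : ℝ)..P, w s ^ 2 :=
    intervalIntegral.integral_pos hP (hw.pow 2).continuousOn (fun x _ => sq_nonneg _)
      ⟨s, hs, by positivity⟩
  linarith

lemma eq_zero_of_integral_rpow_sub_eq_zero {w : ℝ → ℝ} (hw : Continuous w) {β : ℝ}
    (hβ : ∀ j : ℕ, β ≠ j) {P : ℝ} (hP : 0 < P) {τ : ℕ → ℝ} (hτ : Tendsto τ atTop atTop)
    (h : ∀ᶠ j in atTop, ∫ s in (0 : ℝ)..P, (τ j - s) ^ β * w s = 0) :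
    ∀ s ∈ Set.Icc 0 P, w s = 0 :=
  eq_zero_of_forall_moment_eq_zero hw hP
    (moment_eq_zero_of_integral_rpow_sub_eq_zero hw hβ hP hτ h)

/-! ### Periodic functions on the half-line -/

lemma exists_periodic_contDiff_extension {n : ℕ} {g : ℝ → ℝ} {P : ℝ} (hP : 0 < P)
    (hg : ContDiffOn ℝ n g (Set.Ioi 0)) (hper : ∀ t, 0 < t → g (t + P) = g t) :
    ∃ G : ℝ → ℝ, ContDiff ℝ n G ∧ Function.Periodic G P ∧ ∀ t, 0 < t → G t = g t := by
  have hnat : ∀ N : ℕ, ∀ t, 0 < t → g (t + N * P) = g t := by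
    intro N
    induction N with
    | zero => simp
    | succ N ih =>
      intro t ht
      rw [← ih t ht, ← hper (t + N * P) (by positivity)]
      congr 1
      push_cast
      ring
  -- Representatives lie in `(0, P]`, not `[0, P)`, because `g 0` is unconstrained.
  let G : ℝ → ℝ := fun t => g (toIocMod hP 0 t)
  have hGper : Function.Periodic G P := fun t => by simp [G]
  have hGg : ∀ t, 0 < t → G t = g t := by
    intro t ht
    have hmem := toIocMod_mem_Ioc hP 0 t
    have ht' := toIocMod_add_toIocDiv_zsmul hP 0 t
    have hz : 0 ≤ toIocDiv hP 0 t := by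
      by_contra hlt
      have h1 : toIocDiv hP 0 t ≤ -1 := by lia
      have h2 : ((toIocDiv hP 0 t : ℤ) : ℝ) ≤ -1 := by exact_mod_cast h1
      rw [zsmul_eq_mul] at ht'
      nlinarith [hmem.2]
    obtain ⟨N, hN⟩ := Int.eq_ofNat_of_zero_le hz
    rw [hN, zsmul_eq_mul, Int.cast_natCast] at ht'
    change g _ = g t
    rw [← hnat N _ hmem.1, ht']
  refine ⟨G, contDiff_iff_contDiffAt.2 fun t => ?_, hGper, hGg⟩
  -- Shifting by `N` periods moves a neighbourhood of `t` into the half-line, where `g` is smooth.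
  obtain ⟨N, hN⟩ := exists_nat_gt (-t / P)
  have hpos : 0 < t + N * P := by
    rw [div_lt_iff₀ hP] at hN
    linarith
  have hg' : ContDiffAt ℝ n (fun s => g (s + N * P)) t :=
    ContDiffAt.comp t (hg.contDiffAt (Ioi_mem_nhds hpos)) (by fun_prop)
  refine hg'.congr_of_eventuallyEq ?_
  have hc : ContinuousAt (fun s : ℝ => s + N * P) t := by fun_prop
  filter_upwards [hc.eventually (lt_mem_nhds hpos)] with s hs
  rw [← hGg _ hs, ← nsmul_eq_mul, hGper.nsmul N s]

lemma periodic_iteratedDeriv {g : ℝ → ℝ} {P : ℝ} (hg : Function.Periodic g P) (n : ℕ) :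
    Function.Periodic (iteratedDeriv n g) P := by
  intro t
  have h := iteratedDeriv_comp_add_const (n := n) (f := g) (s := P)
  rw [show (fun z => g (z + P)) = g from funext hg] at h
  exact (congrFun h t).symm

lemma Function.Periodic.eq_zero_of_forall_Icc {g : ℝ → ℝ} {P : ℝ} (hg : Function.Periodic g P)
    (hP : 0 < P) (h : ∀ s ∈ Set.Icc 0 P, g s = 0) (t : ℝ) : g t = 0 := by
  obtain ⟨s, hs, hst⟩ := hg.exists_mem_Ico₀ hP t
  rw [hst, h s ⟨hs.1, hs.2.le⟩]

lemma Function.Periodic.exists_abs_le {g : ℝ → ℝ} {P : ℝ} (hg : Function.Periodic g P)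
    (hP : 0 < P) (hc : Continuous g) : ∃ B, ∀ t, |g t| ≤ B := by
  obtain ⟨B, hB⟩ := isCompact_Icc.exists_bound_of_continuousOn (s := Set.Icc 0 P) hc.continuousOn
  refine ⟨B, fun t => ?_⟩
  obtain ⟨s, hs, hst⟩ := hg.exists_mem_Ico₀ hP t
  rw [hst]
  exact hB s ⟨hs.1, hs.2.le⟩

/-! ### Functions with vanishing iterated derivative -/

lemma exists_polynomial_derivative_eq (q : Polynomial ℝ) :
    ∃ p : Polynomial ℝ, Polynomial.derivative p = q := by
  induction q using Polynomial.induction_on' with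
  | add a b ha hb =>
    obtain ⟨p, rfl⟩ := ha
    obtain ⟨r, rfl⟩ := hb
    exact ⟨p + r, by simp⟩
  | monomial n a =>
    refine ⟨Polynomial.monomial (n + 1) (a / (n + 1)), ?_⟩
    rw [Polynomial.derivative_monomial]
    have : (n + 1 : ℝ) ≠ 0 := by positivity
    simp [this]

lemma exists_polynomial_of_iteratedDeriv_eq_zero {n : ℕ} {G : ℝ → ℝ}
    (hG : ContDiffOn ℝ n G (Set.Ioi 0)) (h : ∀ t, 0 < t → iteratedDeriv n G t = 0) :
    ∃ p : Polynomial ℝ, ∀ t, 0 < t → G t = p.eval t := by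
  induction n generalizing G with
  | zero => exact ⟨0, by simpa using h⟩
  | succ n ih =>
    push_cast at hG
    rw [contDiffOn_succ_iff_deriv_of_isOpen isOpen_Ioi] at hG
    obtain ⟨q, hq⟩ := ih hG.2.2 fun t ht => by rw [← iteratedDeriv_succ']; exact h t ht
    obtain ⟨p, rfl⟩ := exists_polynomial_derivative_eq q
    have hd : ∀ t ∈ Set.Ioi (0 : ℝ), DifferentiableAt ℝ G t := fun t ht =>
      (hG.1 t ht).differentiableAt (Ioi_mem_nhds ht)
    obtain ⟨c, hc⟩ := isOpen_Ioi.exists_is_const_of_deriv_eq_zero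
      (f := fun t => G t - p.eval t) (s := Set.Ioi (0 : ℝ)) isPreconnected_Ioi
      (fun t ht => ((hd t ht).sub p.differentiableAt).differentiableWithinAt)
      (fun t ht => by
        rw [deriv_fun_sub (hd t ht) p.differentiableAt, Polynomial.deriv, hq t ht]
        simp)
    refine ⟨p + Polynomial.C c, fun t ht => ?_⟩
    have := hc t ht
    simp only [Polynomial.eval_add, Polynomial.eval_C]
    linarith

/-- A polynomial bounded near infinity has degree at most zero. This serves Caputo with the function
itself, and Riemann-Liouville with the increment of the fractional integral over a period. -/
lemma exists_const_of_iteratedDeriv_eq_zero_of_bounded {n : ℕ} {G : ℝ → ℝ} {B : ℝ}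
    (hG : ContDiffOn ℝ n G (Set.Ioi 0)) (h : ∀ t, 0 < t → iteratedDeriv n G t = 0)
    (hB : ∀ᶠ t in atTop, |G t| ≤ B) : ∃ c, ∀ t, 0 < t → G t = c := by
  obtain ⟨p, hp⟩ := exists_polynomial_of_iteratedDeriv_eq_zero hG h
  have hdeg : p.degree ≤ 0 := by
    rw [← p.isBoundedUnder_abs_atTop_iff]
    refine ⟨B, eventually_map.2 ?_⟩
    filter_upwards [hB, eventually_gt_atTop 0] with t ht ht0
    rwa [← hp t ht0]
  refine ⟨p.coeff 0, fun t ht => ?_⟩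
  rw [hp t ht, Polynomial.eq_C_of_degree_le_zero hdeg]
  simp

/-! ### The fractional integral -/

lemma intervalIntegrable_rpow_sub_mul {κ : ℝ} (hκ : -1 < κ) {w : ℝ → ℝ} (hw : Continuous w)
    (u a b : ℝ) :
    IntervalIntegrable (fun s => (u - s) ^ κ * w s) MeasureTheory.volume a b := by
  have h := (intervalIntegral.intervalIntegrable_rpow' (a := u - a) (b := u - b) hκ).comp_sub_left u
  simp only [sub_sub_cancel] at h
  exact h.mul_continuousOn hw.continuousOn

/-- Split at `P`: by periodicity the part beyond `P` shifts back to the integral up to `u`,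
isolating the memory of the first period. -/
lemma integral_rpow_sub_mul_add_period {κ : ℝ} (hκ : -1 < κ) {w : ℝ → ℝ} (hw : Continuous w)
    {P : ℝ} (hper : Function.Periodic w P) (u : ℝ) :
    ∫ s in (0 : ℝ)..(u + P), (u + P - s) ^ κ * w s
      = (∫ s in (0 : ℝ)..P, (u + P - s) ^ κ * w s) + ∫ s in (0 : ℝ)..u, (u - s) ^ κ * w s := by
  rw [← intervalIntegral.integral_add_adjacent_intervals
    (intervalIntegrable_rpow_sub_mul hκ hw (u + P) 0 P)
    (intervalIntegrable_rpow_sub_mul hκ hw (u + P) P (u + P))]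
  congr 1
  have h := intervalIntegral.integral_comp_add_right (a := 0) (b := u)
    (fun s => (u + P - s) ^ κ * w s) P
  rw [zero_add] at h
  rw [← h]
  refine intervalIntegral.integral_congr fun s _ => ?_
  simp only [hper s, add_sub_add_right_eq_sub]

lemma exists_bound_comp_mul_one_sub {g : ℝ → ℝ} (hg : Continuous g) (u₀ : ℝ) :
    ∃ B, ∀ u ∈ Metric.ball u₀ 1, ∀ y ∈ Set.uIoc (0 : ℝ) 1, ‖g (u * (1 - y))‖ ≤ B := by
  obtain ⟨B, hB⟩ := (isCompact_closedBall (0 : ℝ) (|u₀| + 1)).exists_bound_of_continuousOn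
    hg.continuousOn
  refine ⟨B, fun u hu y hy => hB _ ?_⟩
  rw [Set.uIoc_of_le zero_le_one] at hy
  rw [mem_closedBall_zero_iff, norm_mul]
  have h1 : ‖1 - y‖ ≤ 1 := by
    rw [Real.norm_eq_abs, abs_le]; constructor <;> linarith [hy.1, hy.2]
  have h2 : ‖u‖ ≤ |u₀| + 1 := by
    have h3 : |u - u₀| < 1 := by simpa [Real.dist_eq] using hu
    have h4 := abs_add_le (u - u₀) u₀
    rw [sub_add_cancel] at h4
    rw [Real.norm_eq_abs]
    linarith
  calc ‖u‖ * ‖1 - y‖ ≤ ‖u‖ * 1 := by gcongr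
    _ ≤ |u₀| + 1 := by rw [mul_one]; exact h2

/-- Differentiation under the integral produces a factor `1 - y`, absorbed into the weight; hence
the induction over arbitrary integrable `φ`. -/
lemma contDiff_integral_mul_comp {n : ℕ} {φ g : ℝ → ℝ}
    (hφ : IntervalIntegrable φ MeasureTheory.volume 0 1) (hg : ContDiff ℝ n g) :
    ContDiff ℝ n (fun u => ∫ y in (0 : ℝ)..1, φ y * g (u * (1 - y))) := by
  have hint : ∀ {ψ g : ℝ → ℝ}, IntervalIntegrable ψ MeasureTheory.volume 0 1 → Continuous g →
      ∀ u : ℝ, IntervalIntegrable (fun y => ψ y * g (u * (1 - y))) MeasureTheory.volume 0 1 :=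
    fun hψ hg u => hψ.mul_continuousOn (by fun_prop)
  induction n generalizing φ g with
  | zero =>
    have hg := hg.continuous
    refine contDiff_zero.2 (continuous_iff_continuousAt.2 fun u₀ => ?_)
    obtain ⟨B, hB⟩ := exists_bound_comp_mul_one_sub hg u₀
    refine intervalIntegral.continuousAt_of_dominated_interval (bound := fun y => ‖φ y‖ * B)
      (Eventually.of_forall fun u => (hint hφ hg u).def'.aestronglyMeasurable) ?_
      (hφ.norm.mul_const B) ?_
    · filter_upwards [Metric.ball_mem_nhds u₀ one_pos] with u hu
      refine Eventually.of_forall fun y hy => ?_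
      rw [norm_mul]
      gcongr
      exact hB u hu y hy
    · exact Eventually.of_forall fun y _ => by fun_prop
  | succ n ih =>
    push_cast at hg ⊢
    have hg' := (contDiff_succ_iff_deriv.1 hg)
    have hdc : Continuous (deriv g) := hg'.2.2.continuous
    have hφ' : IntervalIntegrable (fun y => φ y * (1 - y)) MeasureTheory.volume 0 1 :=
      hφ.mul_continuousOn (by fun_prop)
    have hder : ∀ u₀ : ℝ, HasDerivAt (fun u => ∫ y in (0 : ℝ)..1, φ y * g (u * (1 - y)))
        (∫ y in (0 : ℝ)..1, φ y * (1 - y) * deriv g (u₀ * (1 - y))) u₀ := by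
      intro u₀
      obtain ⟨B, hB⟩ := exists_bound_comp_mul_one_sub hdc u₀
      refine (intervalIntegral.hasDerivAt_integral_of_dominated_loc_of_deriv_le
        (F' := fun u y => φ y * (1 - y) * deriv g (u * (1 - y)))
        (bound := fun y => ‖φ y * (1 - y)‖ * B) (Metric.ball_mem_nhds u₀ one_pos)
        (Eventually.of_forall fun u => (hint hφ hg.continuous u).def'.aestronglyMeasurable)
        (hint hφ hg.continuous u₀) (hint hφ' hdc u₀).def'.aestronglyMeasurable ?_
        (hφ'.norm.mul_const B) ?_).2
      · refine Eventually.of_forall fun y hy u hu => ?_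
        rw [norm_mul]
        gcongr
        exact hB u hu y hy
      · refine Eventually.of_forall fun y _ u _ => ?_
        have h1 : HasDerivAt (fun u : ℝ => u * (1 - y)) (1 - y) u := by
          simpa using (hasDerivAt_id u).mul_const (1 - y)
        have h2 := ((hg'.1 (u * (1 - y))).hasDerivAt.comp u h1).const_mul (φ y)
        exact h2.congr_deriv (by ring)
    refine contDiff_succ_iff_deriv.2 ⟨fun u => (hder u).differentiableAt, by simp, ?_⟩
    rw [funext fun u => (hder u).deriv]
    exact ih hφ' hg'.2.2

/-- The substitution `s = u * (1 - y)` takes `u` out of the singular kernel, leaving the prefactor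
`u ^ (κ + 1)`, smooth away from `0`. -/
lemma contDiffOn_integral_rpow_sub_mul {κ : ℝ} (hκ : -1 < κ) {n : ℕ} {g : ℝ → ℝ}
    (hg : ContDiff ℝ n g) :
    ContDiffOn ℝ n (fun u => ∫ s in (0 : ℝ)..u, (u - s) ^ κ * g s) (Set.Ioi 0) := by
  have hsm : ContDiffOn ℝ n
      (fun u : ℝ => u ^ (κ + 1) * ∫ y in (0 : ℝ)..1, y ^ κ * g (u * (1 - y))) (Set.Ioi 0) := by
    refine ContDiffOn.mul ?_ (contDiff_integral_mul_comp
      (intervalIntegral.intervalIntegrable_rpow' hκ) hg).contDiffOn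
    exact contDiffOn_id.rpow_const_of_ne fun u hu => (Set.mem_Ioi.1 hu).ne'
  refine hsm.congr fun u hu => ?_
  have hu : 0 < u := hu
  have h1 := intervalIntegral.integral_comp_sub_left (a := 0) (b := u)
    (fun v => v ^ κ * g (u - v)) u
  simp only [sub_sub_cancel, sub_self, sub_zero] at h1
  have h2 := intervalIntegral.smul_integral_comp_mul_left (a := 0) (b := 1)
    (fun v => v ^ κ * g (u - v)) u
  simp only [mul_zero, mul_one, smul_eq_mul] at h2
  rw [h1, ← h2, Real.rpow_add_one hu.ne', mul_comm (u ^ κ) u, mul_assoc,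
    ← intervalIntegral.integral_const_mul (u ^ κ)]
  congr 1
  refine intervalIntegral.integral_congr fun y hy => ?_
  rw [Set.uIcc_of_le zero_le_one] at hy
  rw [Real.mul_rpow hu.le hy.1, mul_assoc]
  congr 3
  ring

/-! ### Periodicity of the Caputo and Riemann-Liouville derivatives -/

lemma natCast_add_tendsto_atTop (a : ℝ) : Tendsto (fun j : ℕ => (j : ℝ) + a) atTop atTop :=
  tendsto_atTop_add_const_right _ _ tendsto_natCast_atTop_atTop

lemma ne_natCast_of_neg {κ : ℝ} (hκ : κ < 0) (j : ℕ) : κ ≠ j :=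
  (hκ.trans_le j.cast_nonneg).ne

lemma eq_zero_of_integral_rpow_sub_mul_periodic {κ : ℝ} (hκ : -1 < κ) (hκ0 : κ < 0) {w : ℝ → ℝ}
    (hw : Continuous w) {P : ℝ} (hP : 0 < P) (hper : Function.Periodic w P)
    (h : ∀ u, 0 < u → ∫ s in (0 : ℝ)..(u + P), (u + P - s) ^ κ * w s
      = ∫ s in (0 : ℝ)..u, (u - s) ^ κ * w s) (t : ℝ) : w t = 0 := by
  refine hper.eq_zero_of_forall_Icc hP ?_ t
  refine eq_zero_of_integral_rpow_sub_eq_zero hw (ne_natCast_of_neg hκ0) hP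
    (natCast_add_tendsto_atTop P) ?_
  filter_upwards [eventually_gt_atTop 0] with j hj
  have := h j (by exact_mod_cast hj)
  rw [integral_rpow_sub_mul_add_period hκ hw hper] at this
  linarith

lemma tendsto_integral_rpow_sub_mul_zero {κ : ℝ} (hκ0 : κ < 0) {w : ℝ → ℝ}
    (hw : Continuous w) {P : ℝ} (hP : 0 < P) :
    Tendsto (fun u : ℝ => ∫ s in (0 : ℝ)..P, (u + P - s) ^ κ * w s) atTop (𝓝 0) := by
  obtain ⟨B, hB⟩ := isCompact_Icc.exists_bound_of_continuousOn (s := Set.Icc 0 P) hw.continuousOn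
  have hlim : Tendsto (fun u : ℝ => u ^ κ * B * P) atTop (𝓝 0) := by
    have := (tendsto_rpow_neg_atTop (neg_pos.2 hκ0)).mul_const (B * P)
    simpa [mul_assoc] using this
  refine squeeze_zero_norm' ?_ hlim
  filter_upwards [eventually_gt_atTop 0] with u hu
  have := intervalIntegral.norm_integral_le_of_norm_le_const (a := 0) (b := P)
    (f := fun s => (u + P - s) ^ κ * w s) (C := u ^ κ * B) fun s hs => by
      rw [Set.uIoc_of_le hP.le] at hs
      have hpos : 0 < u + P - s := by linarith [hs.2]
      rw [norm_mul, Real.norm_of_nonneg (Real.rpow_nonneg hpos.le κ)]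
      exact mul_le_mul (Real.rpow_le_rpow_of_nonpos hu (by linarith [hs.2]) hκ0.le)
        (hB s ⟨hs.1.le, hs.2⟩) (norm_nonneg _) (Real.rpow_nonneg hu.le κ)
  rwa [sub_zero, abs_of_pos hP] at this

/-- The increment `F (u + P) - F u` has zero `n`-th derivative, and it tends to `0` because it only
sees the first period through a decaying kernel. A bounded polynomial with limit `0` vanishes, so
the `n` derivatives can be stripped off. -/
lemma eq_zero_of_iteratedDeriv_integral_rpow_sub_mul_periodic {κ : ℝ} (hκ : -1 < κ) (hκ0 : κ < 0)
    {n : ℕ} {g : ℝ → ℝ} (hg : ContDiff ℝ n g) {P : ℝ} (hP : 0 < P) (hper : Function.Periodic g P)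
    (h : ∀ t, 0 < t →
      iteratedDeriv n (fun u => ∫ s in (0 : ℝ)..u, (u - s) ^ κ * g s) (t + P)
        = iteratedDeriv n (fun u => ∫ s in (0 : ℝ)..u, (u - s) ^ κ * g s) t) (t : ℝ) :
    g t = 0 := by
  set F : ℝ → ℝ := fun u => ∫ s in (0 : ℝ)..u, (u - s) ^ κ * g s with hF
  have hFs : ContDiffOn ℝ n F (Set.Ioi 0) := contDiffOn_integral_rpow_sub_mul hκ hg
  have hFshift : ContDiffOn ℝ n (fun u => F (u + P)) (Set.Ioi 0) :=
    hFs.comp (t := Set.Ioi 0) (by fun_prop) fun u hu => add_pos hu hP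
  have hFG : ∀ u, F (u + P) - F u = ∫ s in (0 : ℝ)..P, (u + P - s) ^ κ * g s := fun u => by
    simp only [hF, integral_rpow_sub_mul_add_period hκ hg.continuous hper u, add_sub_cancel_right]
  have hlim : Tendsto (fun u => F (u + P) - F u) atTop (𝓝 0) := by
    simp_rw [hFG]
    exact tendsto_integral_rpow_sub_mul_zero hκ0 hg.continuous hP
  have hder : ∀ t, 0 < t → iteratedDeriv n (fun u => F (u + P) - F u) t = 0 := by
    intro t ht
    rw [iteratedDeriv_fun_sub (hFshift.contDiffAt (Ioi_mem_nhds ht))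
      (hFs.contDiffAt (Ioi_mem_nhds ht)), iteratedDeriv_comp_add_const]
    exact sub_eq_zero.2 (h t ht)
  have hbd : ∀ᶠ u in atTop, |F (u + P) - F u| ≤ 1 := by
    filter_upwards [hlim.abs.eventually_lt_const (by simp : |(0 : ℝ)| < 1)] with u hu using hu.le
  obtain ⟨c, hc⟩ := exists_const_of_iteratedDeriv_eq_zero_of_bounded (hFshift.sub hFs) hder hbd
  have hc0 : c = 0 := by
    refine tendsto_nhds_unique (tendsto_const_nhds.congr' ?_) hlim
    filter_upwards [eventually_gt_atTop 0] with u hu using (hc u hu).symm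
  refine eq_zero_of_integral_rpow_sub_mul_periodic hκ hκ0 hg.continuous hP hper (fun u hu => ?_) t
  have := hc u hu
  simp only [hF, hc0] at this
  linarith

/-! ### Riemann sums -/

lemma tendsto_riemannSum {φ : ℝ → ℝ} (hφ : ContinuousOn φ (Set.Icc 0 1)) :
    Tendsto (fun N : ℕ => (N : ℝ)⁻¹ * ∑ i ∈ Finset.range N, φ (i / N)) atTop
      (𝓝 (∫ x in (0 : ℝ)..1, φ x)) := by
  rw [Metric.tendsto_atTop]
  intro ε hε
  obtain ⟨δ, hδ, hunif⟩ := Metric.uniformContinuousOn_iff_le.1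
    (isCompact_Icc.uniformContinuousOn_of_continuous hφ) (ε / 2) (by positivity)
  obtain ⟨N₀, hN₀⟩ := exists_nat_gt δ⁻¹
  refine ⟨N₀ + 1, fun N hN => ?_⟩
  have hNpos : (0 : ℝ) < N := by exact_mod_cast (by lia : 0 < N)
  have hNδ : (N : ℝ)⁻¹ ≤ δ := by
    have : (N₀ : ℝ) ≤ N := by exact_mod_cast (by lia : N₀ ≤ N)
    exact inv_le_of_inv_le₀ hδ (by linarith)
  have hmem : ∀ i : ℕ, i ≤ N → (i / N : ℝ) ∈ Set.Icc (0 : ℝ) 1 := fun i hi =>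
    ⟨by positivity, (div_le_one hNpos).2 (by exact_mod_cast hi)⟩
  have hle : ∀ i : ℕ, (i / N : ℝ) ≤ ((i + 1 : ℕ) : ℝ) / N := fun i => by gcongr; simp
  have hint : ∀ i < N, IntervalIntegrable φ MeasureTheory.volume (i / N) ((i + 1 : ℕ) / N) := by
    intro i hi
    refine (hφ.mono ?_).intervalIntegrable
    rw [Set.uIcc_of_le (hle i)]
    exact Set.Icc_subset_Icc (hmem i hi.le).1 (hmem (i + 1) hi).2
  have hsplit : ∫ x in (0 : ℝ)..1, φ x
      = ∑ i ∈ Finset.range N, ∫ x in (i / N : ℝ)..((i + 1 : ℕ) / N), φ x := by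
    rw [intervalIntegral.sum_integral_adjacent_intervals (a := fun i : ℕ => (i / N : ℝ)) hint]
    simp [hNpos.ne']
  have hterm : ∀ i ∈ Finset.range N,
      ‖(N : ℝ)⁻¹ * φ (i / N) - ∫ x in (i / N : ℝ)..((i + 1 : ℕ) / N), φ x‖ ≤ ε / 2 * (N : ℝ)⁻¹ := by
    intro i hi
    have hi := Finset.mem_range.1 hi
    have hlen : ((i + 1 : ℕ) / N - i / N : ℝ) = (N : ℝ)⁻¹ := by push_cast; field_simp; ring
    have hconst : (N : ℝ)⁻¹ * φ (i / N) = ∫ _ in (i / N : ℝ)..((i + 1 : ℕ) / N), φ (i / N) := by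
      rw [intervalIntegral.integral_const, hlen, smul_eq_mul]
    rw [hconst, ← intervalIntegral.integral_sub intervalIntegrable_const (hint i hi)]
    refine (intervalIntegral.norm_integral_le_of_norm_le_const (C := ε / 2) fun x hx => ?_).trans_eq
      (by rw [hlen, abs_of_pos (inv_pos.2 hNpos)])
    rw [Set.uIoc_of_le (hle i)] at hx
    refine hunif _ (hmem i hi.le) x ⟨(hmem i hi.le).1.trans hx.1.le,
      hx.2.trans (hmem (i + 1) hi).2⟩ ?_
    rw [Real.dist_eq, abs_sub_comm, abs_of_nonneg (by linarith [hx.1])]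
    linarith [hx.2]
  rw [hsplit, Finset.mul_sum, dist_eq_norm, ← Finset.sum_sub_distrib]
  refine (norm_sum_le_of_le _ hterm).trans_lt ?_
  rw [Finset.sum_const, Finset.card_range, nsmul_eq_mul]
  field_simp
  linarith

/-- As `j > 0`, all indices `j * N + i` are at least `N`, so the weights are uniformly close to `L`.
-/
lemma tendsto_weighted_riemannSum {φ : ℝ → ℝ} (hφ : ContinuousOn φ (Set.Icc 0 1)) {d : ℕ → ℝ}
    {L : ℝ} (hd : Tendsto d atTop (𝓝 L)) {j : ℕ} (hj : 0 < j) :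
    Tendsto (fun N : ℕ => (N : ℝ)⁻¹ * ∑ i ∈ Finset.range N, d (j * N + i) * φ (i / N)) atTop
      (𝓝 (L * ∫ x in (0 : ℝ)..1, φ x)) := by
  obtain ⟨B, hB⟩ := isCompact_Icc.exists_bound_of_continuousOn hφ
  have hB0 : 0 ≤ B := (norm_nonneg _).trans (hB 0 ⟨le_rfl, zero_le_one⟩)
  have herr : Tendsto (fun N : ℕ => (N : ℝ)⁻¹ *
      ∑ i ∈ Finset.range N, (d (j * N + i) - L) * φ (i / N)) atTop (𝓝 0) := by
    rw [Metric.tendsto_atTop] at hd ⊢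
    intro ε hε
    obtain ⟨N₀, hN₀⟩ := hd (ε / (B + 1)) (by positivity)
    refine ⟨N₀ + 1, fun N hN => ?_⟩
    have hNpos : (0 : ℝ) < N := by exact_mod_cast (by lia : 0 < N)
    have hterm : ∀ i ∈ Finset.range N,
        ‖(d (j * N + i) - L) * φ (i / N)‖ ≤ ε / (B + 1) * B := by
      intro i hi
      have hi := Finset.mem_range.1 hi
      rw [norm_mul]
      refine mul_le_mul ?_ (hB _ ⟨by positivity, (div_le_one hNpos).2 (by exact_mod_cast hi.le)⟩)
        (norm_nonneg _) (by positivity)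
      rw [← dist_eq_norm]
      exact (hN₀ _ (by nlinarith)).le
    rw [dist_zero_right, norm_mul, norm_inv, Real.norm_of_nonneg hNpos.le]
    calc (N : ℝ)⁻¹ * ‖∑ i ∈ Finset.range N, (d (j * N + i) - L) * φ (i / N)‖
        ≤ (N : ℝ)⁻¹ * ∑ i ∈ Finset.range N, ε / (B + 1) * B := by
          gcongr; exact norm_sum_le_of_le _ hterm
      _ = ε * (B / (B + 1)) := by
          rw [Finset.sum_const, Finset.card_range, nsmul_eq_mul]; field_simp
      _ < ε * 1 := by gcongr; rw [div_lt_one (by positivity)]; linarith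
      _ = ε := mul_one ε
  have h := herr.add ((tendsto_riemannSum hφ).const_mul L)
  rw [zero_add] at h
  refine h.congr fun N => ?_
  rw [mul_left_comm, ← mul_add, Finset.mul_sum, ← Finset.sum_add_distrib]
  congr 1
  exact Finset.sum_congr rfl fun i _ => by ring

/-! ### Periodicity of the Grunwald-Letnikov derivative -/

/-- Periodicity removes `j` from the arguments of `G`, so the sums for `j` and `j + 1` have common
terms. The last node is exactly `0`, where `g` need not agree with `G`, and is kept apart. -/
lemma glQuotient_natCast_mul_div {α : ℝ} {g G : ℝ → ℝ} {P : ℝ} (hP : 0 < P)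
    (hper : Function.Periodic G P) (hgG : ∀ t, 0 < t → G t = g t) (j : ℕ) {N : ℕ} (hN : 0 < N) :
    glQuotient α g (j * P) (P / N) = (P / N) ^ (-α) *
      (∑ r ∈ Finset.range (j * N), (-1 : ℝ) ^ r * Ring.choose α r * G (-(r / N * P))
        + (-1 : ℝ) ^ (j * N) * Ring.choose α (j * N) * g 0) := by
  have hN' : (0 : ℝ) < N := by exact_mod_cast hN
  have hfloor : ⌊(j * P) / (P / N)⌋₊ = j * N := by
    rw [show (j * P) / (P / N) = ((j * N : ℕ) : ℝ) by push_cast; field_simp, Nat.floor_natCast]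
  rw [glQuotient, hfloor, Finset.sum_range_succ]
  congr 2
  · refine Finset.sum_congr rfl fun r hr => ?_
    have hr' : (r : ℝ) < j * N := by exact_mod_cast Finset.mem_range.1 hr
    have hpos : 0 < j * P - r * (P / N) := by
      have : j * P - r * (P / N) = (j * N - r) * (P / N) := by field_simp
      rw [this]
      exact mul_pos (by linarith) (by positivity)
    rw [← hgG _ hpos, show (j * P - r * (P / N) : ℝ) = -(r / N * P) + j * P by ring,
      ← nsmul_eq_mul, hper.nsmul j]
  · congr 2
    push_cast
    field_simp
    ring

lemma tendsto_const_div_natCast_nhdsGT {P : ℝ} (hP : 0 < P) :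
    Tendsto (fun N : ℕ => P / N) atTop (𝓝[>] 0) := by
  refine tendsto_nhdsWithin_iff.2 ⟨tendsto_const_div_atTop_nhds_zero_nat P, ?_⟩
  filter_upwards [eventually_gt_atTop 0] with N hN
  have : (0 : ℝ) < N := by exact_mod_cast hN
  exact div_pos hP this

lemma tendsto_rpow_neg_mul_ring_choose {α : ℝ} (hα : ∀ j : ℕ, α ≠ j) {P : ℝ} (hP : 0 < P) {j : ℕ}
    (hj : 0 < j) :
    Tendsto (fun N : ℕ => (P / N) ^ (-α) * ((-1 : ℝ) ^ (j * N) * Ring.choose α (j * N)))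
      atTop (𝓝 0) := by
  have hmul : Tendsto (fun N : ℕ => j * N) atTop atTop :=
    tendsto_id.const_mul_atTop' hj
  have h := ((tendsto_ring_choose_mul_rpow_self hα).comp hmul).const_mul ((j * P) ^ (-α))
  rw [mul_zero] at h
  refine h.congr' ?_
  filter_upwards [eventually_gt_atTop 0] with N hN
  have hN' : (0 : ℝ) < N := by exact_mod_cast hN
  have hj' : (0 : ℝ) < j := by exact_mod_cast hj
  have e : (P / N : ℝ) ^ (-α) = (j * P) ^ (-α) * ((j * N : ℕ) : ℝ) ^ α := by
    rw [show (P / N : ℝ) = (j * P) / ((j * N : ℕ) : ℝ) by push_cast; field_simp,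
      Real.div_rpow (by positivity) (by positivity), Real.rpow_neg (Nat.cast_nonneg (j * N)),
      div_inv_eq_mul]
  rw [e]
  simp only [Function.comp_apply]
  ring

/-- Only the indices `r = j * N + i` with `i < N` survive, apart from the `g 0` terms, which tend to
`0`. Writing `r = N * (j + i / N)` in the asymptotics of the coefficients, the powers of `N` combine
to the mesh `1 / N`. Taking `j > 0` keeps the limiting kernel nonsingular. -/
lemma tendsto_glQuotient_sub {α : ℝ} (hα : ∀ j : ℕ, α ≠ j) {g G : ℝ → ℝ} {P : ℝ} (hP : 0 < P)
    (hG : Continuous G) (hper : Function.Periodic G P) (hgG : ∀ t, 0 < t → G t = g t) {j : ℕ}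
    (hj : 0 < j) :
    Tendsto (fun N : ℕ => glQuotient α g ((j + 1 : ℕ) * P) (P / N) - glQuotient α g (j * P) (P / N))
      atTop (𝓝 (P ^ (-α) * ((Real.Gamma (-α))⁻¹ *
        ∫ x in (0 : ℝ)..1, (j + x) ^ (-α - 1) * G (-(x * P))))) := by
  have hj' : (0 : ℝ) < j := by exact_mod_cast hj
  have hφ : ContinuousOn (fun x : ℝ => (j + x) ^ (-α - 1) * G (-(x * P))) (Set.Icc 0 1) := by
    refine ContinuousOn.mul (ContinuousOn.rpow_const (by fun_prop) fun x hx => Or.inl ?_)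
      (by fun_prop)
    linarith [hx.1]
  have hmain := (tendsto_weighted_riemannSum hφ (tendsto_ring_choose_mul_rpow hα) hj).const_mul
    (P ^ (-α))
  have hb := ((tendsto_rpow_neg_mul_ring_choose hα hP j.succ_pos).sub
    (tendsto_rpow_neg_mul_ring_choose hα hP hj)).mul_const (g 0)
  have h := hmain.add hb
  rw [sub_zero, zero_mul, add_zero] at h
  refine h.congr' ?_
  filter_upwards [eventually_gt_atTop 0] with N hN
  have hN' : (0 : ℝ) < N := by exact_mod_cast hN
  rw [glQuotient_natCast_mul_div hP hper hgG (j + 1) hN, glQuotient_natCast_mul_div hP hper hgG j hN,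
    show (j + 1) * N = j * N + N by ring, Finset.sum_range_add]
  have hsum : (P / N : ℝ) ^ (-α) * ∑ i ∈ Finset.range N, (-1 : ℝ) ^ (j * N + i) *
      Ring.choose α (j * N + i) * G (-(((j * N + i : ℕ) : ℝ) / N * P))
      = P ^ (-α) * ((N : ℝ)⁻¹ * ∑ i ∈ Finset.range N, (-1 : ℝ) ^ (j * N + i) *
        Ring.choose α (j * N + i) * ((j * N + i : ℕ) : ℝ) ^ (α + 1) *
          ((j + (i / N : ℝ)) ^ (-α - 1) * G (-((i / N : ℝ) * P)))) := by
    rw [Finset.mul_sum, Finset.mul_sum, Finset.mul_sum]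
    refine Finset.sum_congr rfl fun i _ => ?_
    have hG' : G (-(((j * N + i : ℕ) : ℝ) / N * P)) = G (-((i / N : ℝ) * P)) := by
      rw [← hper.nsmul j (-(((j * N + i : ℕ) : ℝ) / N * P))]
      congr 1
      rw [nsmul_eq_mul]
      push_cast
      field_simp
      ring
    have hq : (0 : ℝ) < j + i / N := by positivity
    have hpow : ((j * N + i : ℕ) : ℝ) ^ (α + 1) * (j + (i / N : ℝ)) ^ (-α - 1)
        = (N : ℝ) ^ (α + 1) := by
      rw [show ((j * N + i : ℕ) : ℝ) = N * (j + i / N) by push_cast; field_simp,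
        Real.mul_rpow hN'.le hq.le, mul_assoc, ← Real.rpow_add hq]
      simp
    have hdiv : (P / N : ℝ) ^ (-α) = P ^ (-α) * ((N : ℝ)⁻¹ * (N : ℝ) ^ (α + 1)) := by
      rw [Real.div_rpow hP.le hN'.le, Real.rpow_neg hN'.le, div_inv_eq_mul,
        Real.rpow_add_one hN'.ne']
      field_simp
    rw [hG', hdiv, ← hpow]
    ring
  linear_combination -hsum

lemma eq_zero_of_glDeriv_periodic {α : ℝ} (hα : ∀ j : ℕ, α ≠ j) (hα0 : 0 < α) {g G : ℝ → ℝ} {P : ℝ}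
    (hP : 0 < P) (hG : Continuous G) (hper : Function.Periodic G P)
    (hgG : ∀ t, 0 < t → G t = g t) {y : ℝ → ℝ}
    (hy : ∀ t, 0 < t → Tendsto (glQuotient α g t) (𝓝[>] 0) (𝓝 (y t)))
    (hyper : ∀ t, 0 < t → y (t + P) = y t) (t : ℝ) : G t = 0 := by
  have hzero : ∀ j : ℕ, 0 < j →
      ∫ x in (0 : ℝ)..1, (j + x) ^ (-α - 1) * G (-(x * P)) = 0 := by
    intro j hj
    have hj' : (0 : ℝ) < j := by exact_mod_cast hj
    have hjP : 0 < j * P := by positivity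
    have h1 := (hy ((j + 1 : ℕ) * P) (by positivity)).comp (tendsto_const_div_natCast_nhdsGT hP)
    have h2 := (hy (j * P) hjP).comp (tendsto_const_div_natCast_nhdsGT hP)
    have h3 := h1.sub h2
    have e : y ((j + 1 : ℕ) * P) = y (j * P) := by
      rw [← hyper _ hjP]
      congr 1
      push_cast
      ring
    rw [e, sub_self] at h3
    have h4 := tendsto_nhds_unique (tendsto_glQuotient_sub hα hP hG hper hgG hj) h3
    have hΓ : Real.Gamma (-α) ≠ 0 := Real.Gamma_ne_zero fun m h => hα m (by linarith)
    exact (mul_eq_zero.1 ((mul_eq_zero.1 h4).resolve_left (Real.rpow_pos_of_pos hP _).ne')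
      ).resolve_left (inv_ne_zero hΓ)
  refine hper.eq_zero_of_forall_Icc hP ?_ t
  -- The exponent is below `-1`, which is harmless: the times `(j + 1) * P` with `j > 0` stay off
  -- `[0, P]`. The substitution `s = P - x * P` matches the two integrals.
  refine eq_zero_of_integral_rpow_sub_eq_zero hG (β := -α - 1) (ne_natCast_of_neg (by linarith)) hP
    (τ := fun j : ℕ => ((j : ℝ) + 1) * P) ((natCast_add_tendsto_atTop 1).atTop_mul_const hP) ?_
  filter_upwards [eventually_gt_atTop 0] with j hj
  have hj' : (0 : ℝ) < j := by exact_mod_cast hj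
  have h1 := intervalIntegral.integral_comp_sub_left (a := 0) (b := P)
    (fun s => ((j + 1) * P - s) ^ (-α - 1) * G s) P
  rw [sub_self, sub_zero] at h1
  have h2 := intervalIntegral.smul_integral_comp_mul_right (a := 0) (b := 1)
    (fun s => ((j + 1) * P - (P - s)) ^ (-α - 1) * G (P - s)) P
  rw [zero_mul, one_mul] at h2
  rw [← h1, ← h2]
  have h3 : ∀ x ∈ Set.uIcc (0 : ℝ) 1,
      ((j + 1) * P - (P - x * P)) ^ (-α - 1) * G (P - x * P)
        = P ^ (-α - 1) * ((j + x) ^ (-α - 1) * G (-(x * P))) := by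
    intro x hx
    rw [Set.uIcc_of_le zero_le_one] at hx
    rw [show ((j + 1) * P - (P - x * P) : ℝ) = P * (j + x) by ring,
      Real.mul_rpow hP.le (by linarith [hx.1]), show P - x * P = -(x * P) + P by ring, hper]
    ring
  rw [intervalIntegral.integral_congr h3, intervalIntegral.integral_const_mul, hzero j hj]
  simp

/-! ### The main result -/

/-- The lower bound makes the kernel integrable. The upper bound is where non-integrality enters: at
an integer order the kernel would be constant. -/
lemma fracOrder_sub_mem {α : ℝ} (hα0 : 0 < α) (hα : ∀ j : ℕ, α ≠ j) :
    -1 < (fracOrder α : ℝ) - α - 1 ∧ (fracOrder α : ℝ) - α - 1 < 0 := by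
  have h1 := Nat.lt_floor_add_one α
  have h2 : (⌊α⌋₊ : ℝ) < α := lt_of_le_of_ne (Nat.floor_le hα0.le) (hα _).symm
  simp only [fracOrder]
  push_cast
  constructor <;> linarith

/-- A function on the half-line that is periodic together with its fractional derivative, for any
of the three kinds, is constant. -/
lemma exists_const_of_hasFracDeriv_periodic {K : FracKind} {α : ℝ} (hα0 : 0 < α)
    (hα : ∀ j : ℕ, α ≠ j) {g y : ℝ → ℝ} (hg : ContDiffOn ℝ (fracOrder α : ℕ) g (Set.Ioi 0))
    {P : ℝ} (hP : 0 < P) (hper : ∀ t, 0 < t → g (t + P) = g t)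
    (hy : ∀ t, 0 < t → HasFracDeriv K α g t (y t)) (hyper : ∀ t, 0 < t → y (t + P) = y t) :
    ∃ c, ∀ t, 0 < t → g t = c := by
  obtain ⟨hκ, hκ0⟩ := fracOrder_sub_mem hα0 hα
  have hΓ : 1 / Real.Gamma ((fracOrder α : ℝ) - α) ≠ 0 :=
    one_div_ne_zero (Real.Gamma_pos_of_pos (by linarith)).ne'
  obtain ⟨G, hG, hGper, hGg⟩ := exists_periodic_contDiff_extension hP hg hper
  have hmem : ∀ {t s : ℝ}, 0 < t → s ∈ Set.uIoc 0 t → 0 < s := fun ht hs => by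
    rw [Set.uIoc_of_le ht.le] at hs
    exact hs.1
  cases K with
  | caputo =>
    have hint : ∀ t, 0 < t → caputoDeriv α g t = 1 / Real.Gamma ((fracOrder α : ℝ) - α) *
        ∫ s in (0 : ℝ)..t, (t - s) ^ ((fracOrder α : ℝ) - α - 1) *
          iteratedDeriv (fracOrder α) G s := by
      intro t ht
      rw [caputoDeriv]
      congr 1
      refine intervalIntegral.integral_congr_ae (Eventually.of_forall fun s hs => ?_)
      congr 1
      refine Filter.EventuallyEq.iteratedDeriv_eq _ ?_
      filter_upwards [Ioi_mem_nhds (hmem ht hs)] with u hu using (hGg u hu).symm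
    have hw := eq_zero_of_integral_rpow_sub_mul_periodic hκ hκ0
      (hG.continuous_iteratedDeriv _ le_rfl) hP (periodic_iteratedDeriv hGper _) fun u hu => by
        have h1 := hy (u + P) (by positivity)
        have h2 := hy u hu
        simp only [HasFracDeriv] at h1 h2
        rw [hint _ (by positivity), hyper u hu, ← h2, hint u hu] at h1
        exact mul_left_cancel₀ hΓ h1
    obtain ⟨B, hB⟩ := hGper.exists_abs_le hP hG.continuous
    obtain ⟨c, hc⟩ := exists_const_of_iteratedDeriv_eq_zero_of_bounded hG.contDiffOn
      (fun t _ => hw t) (Eventually.of_forall hB)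
    exact ⟨c, fun t ht => by rw [← hGg t ht, hc t ht]⟩
  | riemannLiouville =>
    have hder : ∀ t, 0 < t → rlDeriv α g t = 1 / Real.Gamma ((fracOrder α : ℝ) - α) *
        iteratedDeriv (fracOrder α)
          (fun u => ∫ s in (0 : ℝ)..u, (u - s) ^ ((fracOrder α : ℝ) - α - 1) * G s) t := by
      intro t ht
      rw [rlDeriv]
      congr 1
      refine Filter.EventuallyEq.iteratedDeriv_eq _ ?_
      filter_upwards [Ioi_mem_nhds ht] with u hu
      refine intervalIntegral.integral_congr_ae (Eventually.of_forall fun s hs => ?_)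
      rw [hGg s (hmem hu hs)]
    have h0 := eq_zero_of_iteratedDeriv_integral_rpow_sub_mul_periodic hκ hκ0 hG hP hGper
      fun u hu => by
        have h1 := hy (u + P) (by positivity)
        have h2 := hy u hu
        simp only [HasFracDeriv] at h1 h2
        rw [hder _ (by positivity), hyper u hu, ← h2, hder u hu] at h1
        exact mul_left_cancel₀ hΓ h1
    exact ⟨0, fun t ht => by rw [← hGg t ht, h0 t]⟩
  | grunwaldLetnikov =>
    have h0 := eq_zero_of_glDeriv_periodic hα hα0 hP hG.continuous hGper hGg hy hyper
    exact ⟨0, fun t ht => by rw [← hGg t ht, h0 t]⟩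

theorem corollary2 (p m : ℕ) (K : Fin p → FracKind) (α : Fin p → ℝ)
    (hα_pos : ∀ i, 0 < α i) (hα_nonint : ∀ i, ∀ j : ℕ, α i ≠ (j : ℝ))
    (T : ℝ) (hT : 0 < T)
    (f : ℝ → (Fin (m + 1) → Fin p → ℝ) → Fin p → ℝ)
    (hf : ∀ t : ℝ, 0 ≤ t → ∀ v, f (t + T) v = f t v)
    (k : ℕ) (hk : 1 ≤ k) :
    ¬ ∃ x : ℝ → Fin p → ℝ,
        IsClassCn α x ∧
        IsFracSolution K α m f x ∧
        (∀ t : ℝ, 0 < t → x (t + k * T) = x t) ∧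
        ¬ ∃ c : Fin p → ℝ, ∀ t : ℝ, 0 < t → x t = c := by
  rintro ⟨x, hC, hsol, hper, hne⟩
  have hk' : (0 : ℝ) < k := by exact_mod_cast hk
  have hP : 0 < k * T := by positivity
  have hfk : ∀ l : ℕ, ∀ t : ℝ, 0 ≤ t → ∀ v, f (t + l * T) v = f t v := by
    intro l
    induction l with
    | zero => simp
    | succ l ih =>
      intro t ht v
      rw [← ih t ht v, ← hf (t + l * T) (by positivity) v]
      congr 1
      push_cast
      ring
  -- No differentiability is needed, even for `j` beyond the smoothness class: `iteratedDeriv`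
  -- depends only on the germ.
  have hder : ∀ (j : ℕ) (l : Fin p) (t : ℝ), 0 < t →
      iteratedDeriv j (fun s => x s l) (t + k * T) = iteratedDeriv j (fun s => x s l) t := by
    intro j l t ht
    have h := congrFun (iteratedDeriv_comp_add_const (n := j) (f := fun s => x s l) (s := k * T)) t
    rw [← h]
    refine Filter.EventuallyEq.iteratedDeriv_eq _ ?_
    filter_upwards [Ioi_mem_nhds ht] with s hs
    rw [hper s hs]
  have hconst : ∀ i, ∃ c, ∀ t, 0 < t → x t i = c := fun i =>
    exists_const_of_hasFracDeriv_periodic (hα_pos i) (hα_nonint i) (hC i) hP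
      (fun t ht => by rw [hper t ht])
      (fun t ht => (hsol t ht).2 i)
      (fun t ht => by simp only [hder _ _ t ht, hfk k t ht.le])
  choose c hc using hconst
  exact hne ⟨c, fun t ht => funext fun i => hc i t ht⟩
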